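/- Let $\mathcal A=\{H_1,\dots,H_l\}$ be an ordered arrangement of distinct hyperplanes in $\mathbb{CP}^n$, where $H_i$ is the zero set of a nonzero linear form $\alpha_i$ on $\mathbb C^{n+1}$. Let $E$ be the exterior algebra of $\mathbb C^l$ with canonical generators $x_1,\dots,x_l$. The Orlik–Solomon algebra of $\mathcal A$ is $A=E/K$, where $K$ is the two-sided ideal generated by the elements $\sum_{j=1}^m(-1)^j x_{i_1}\wedge\cdots\wedge\widehat{x_{i_j}}\wedge\cdots\wedge x_{i_m}$ for all distinct indices $i_1,\dots,i_m$ such that $H_{i_1}\cap\cdots\cap H_{i_m}\neq\emptyset$ and $\alpha_{i_1},\dots,\alpha_{i_m}$ are linearly dependent, together with the monomials $x_{i_1}\wedge\cdots\wedge x_{i_m}$ for all distinct indices with $H_{i_1}\cap\cdots\cap H_{i_m}=\emptyset$. An NBC monomial is the class in $A$ of $x_{i_1}\wedge\cdots\wedge x_{i_k}$, where $0\le k\le n$, $i_1<\cdots<i_k$, the forms $\alpha_{i_1},\dots,\alpha_{i_k}$ are linearly independent and, for every $1\le j\le k$, $i_j$ is the least index $m$ with $H_m\supseteq H_{i_j}\cap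 H_{i_{j+1}}\cap\cdots\cap H_{i_k}$. Then the NBC monomials (one for each such index tuple) form a basis of the complex vector space $A$. Moreover, let $w_1,\dots,w_n\in\mathbb C^l$, identified with linear combinations of $x_1,\dots,x_l$, and let $v_i\in\mathbb C^n$ $(1\le i\le l)$ be the columns of the $n\times l$ matrix whose rows are $w_1,\dots,w_n$. In the expansion of the product $w_1\wedge\cdots\wedge w_n\in A$ in this basis only NBC monomials of degree $n$ occur, and the coefficient of the NBC monomial $x_{i_1}\wedge\cdots\wedge x_{i_n}$ is the determinant $$\det\Bigl(\ \sum_{H_i\supseteq \bigcap_{j=1}^{n}H_{i_j}}v_i\ ,\ \sum_{H_i\supseteq\bigcap_{j=2}^{n}H_{i_j}}v_i\ ,\ \dots\ ,\ \sum_{H_i\supseteq H_{i_{n-1}}\cap H_{i_n}}v_i\ ,\ v_{i_n}\Bigr),$$ that is, of the $n\times n$ matrix whose $k$-th column is $\sum v_i$ over all $i$ with $H_i\supseteq\bigcap_{j=k}^{n}H_{i_j}$, for $k=1,\dots,n$. -/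

import Mathlib

noncomputable section

/-- The hyperplane of complex projective `n`-space with equation `f = 0`. -/
def projHyperplane {n : ℕ} (f : Module.Dual ℂ (Fin (n + 1) → ℂ)) :
    Set (Projectivization ℂ (Fin (n + 1) → ℂ)) :=
  {p | p.submodule ≤ LinearMap.ker f}

/-- An ordered arrangement of `l` distinct hyperplanes in complex projective `n`-space, each
given by a (nonzero) defining linear form in the homogeneous coordinates. -/
structure ProjArrangement (n l : ℕ) where
  form : Fin l → Module.Dual ℂ (Fin (n + 1) → ℂ)
  form_ne_zero : ∀ i, form i ≠ 0
  distinct : Function.Injective fun i => projHyperplane (form i)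

namespace ProjArrangement

variable {n l : ℕ} (A : ProjArrangement n l)

/-- The `i`-th hyperplane `H_i`. -/
def hyperplane (i : Fin l) : Set (Projectivization ℂ (Fin (n + 1) → ℂ)) :=
  projHyperplane (A.form i)

/-- The intersection `H_{i_1} ∩ ⋯ ∩ H_{i_k}` of a tuple of hyperplanes. -/
def inter {k : ℕ} (i : Fin k → Fin l) : Set (Projectivization ℂ (Fin (n + 1) → ℂ)) :=
  ⋂ j, A.hyperplane (i j)

/-- The tail intersection `H_{i_j} ∩ H_{i_{j+1}} ∩ ⋯ ∩ H_{i_k}`. -/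
def tailInter {k : ℕ} (i : Fin k → Fin l) (j : Fin k) :
    Set (Projectivization ℂ (Fin (n + 1) → ℂ)) :=
  ⋂ r, ⋂ (_ : j ≤ r), A.hyperplane (i r)

/-- The hyperplanes `H_{i_1}, …, H_{i_k}` intersect non-generically: they meet, and their defining
forms are linearly dependent (the codimension of the intersection is less than `k`). -/
def NonGeneric {k : ℕ} (i : Fin k → Fin l) : Prop :=
  (A.inter i).Nonempty ∧ ¬ LinearIndependent ℂ fun j => A.form (i j)

/-- The monomial `x_{i_1} ∧ ⋯ ∧ x_{i_k}` in the exterior algebra `E` of `ℂ^l`. -/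
def extMonomial {l k : ℕ} (i : Fin k → Fin l) : ExteriorAlgebra ℂ (Fin l → ℂ) :=
  ExteriorAlgebra.ιMulti ℂ k fun j => Pi.single (i j) (1 : ℂ)

/-- `∂(x_{i_1} ∧ ⋯ ∧ x_{i_m}) = ∑_j (-1)^j x_{i_1} ∧ ⋯ (omit x_{i_j}) ⋯ ∧ x_{i_m}` for
`m = p + 1`. The position `j` is counted from `0` here, hence the exponent `j + 1`. -/
def extBoundary {l p : ℕ} (i : Fin (p + 1) → Fin l) : ExteriorAlgebra ℂ (Fin l → ℂ) :=
  ∑ j : Fin (p + 1), (-1 : ℂ) ^ ((j : ℕ) + 1) • extMonomial fun r => i (j.succAbove r)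

/-- The Orlik-Solomon ideal `K` of `E`. -/
def osIdeal : TwoSidedIdeal (ExteriorAlgebra ℂ (Fin l → ℂ)) :=
  TwoSidedIdeal.span
    ({y | ∃ (p : ℕ) (i : Fin (p + 1) → Fin l), Function.Injective i ∧ A.NonGeneric i ∧
        y = extBoundary i} ∪
     {y | ∃ (m : ℕ) (i : Fin m → Fin l), Function.Injective i ∧ A.inter i = ∅ ∧
        y = extMonomial i})

/-- The Orlik-Solomon algebra `E / K`. -/
abbrev OSAlgebra : Type := A.osIdeal.ringCon.Quotient

/-- The quotient map `E → E / K`. -/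
def toOS : ExteriorAlgebra ℂ (Fin l → ℂ) →+* A.OSAlgebra := A.osIdeal.ringCon.mk'

/-- The product `w_1 ∧ ⋯ ∧ w_k` in the Orlik-Solomon algebra of vectors of `A^1 = ℂ^l`. -/
def wedge {k : ℕ} (w : Fin k → Fin l → ℂ) : A.OSAlgebra :=
  A.toOS (ExteriorAlgebra.ιMulti ℂ k w)

/-- The monomial `x_{i_1} ∧ ⋯ ∧ x_{i_k}` in the Orlik-Solomon algebra. -/
def monomial {k : ℕ} (i : Fin k → Fin l) : A.OSAlgebra :=
  A.wedge fun j => Pi.single (i j) (1 : ℂ)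

/-- The index tuple `i_1 < ⋯ < i_k` satisfies the non-broken-circuit conditions. -/
structure IsNBC {k : ℕ} (i : Fin k → Fin l) : Prop where
  le_dim : k ≤ n
  strictMono : StrictMono i
  linearIndependent : LinearIndependent ℂ fun j => A.form (i j)
  first : ∀ j, IsLeast {m | A.tailInter i j ⊆ A.hyperplane m} (i j)

/-- The index tuples of the NBC monomials of degree `k`. -/
abbrev NBC (k : ℕ) : Type := {i : Fin k → Fin l // A.IsNBC i}

open Classical in
/-- For `w_1, …, w_n` in `ℂ^l`, let `v_i` be the `i`-th column of the matrix with rows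
`w_1, …, w_n`. The vector attached to a set `S` is the sum of the `v_i` over all `i` with
`S ⊆ H_i`. -/
def decoration (w : Fin n → Fin l → ℂ)
    (S : Set (Projectivization ℂ (Fin (n + 1) → ℂ))) : Fin n → ℂ :=
  ∑ i with S ⊆ A.hyperplane i, fun a => w a i

end ProjArrangement

end

/-! An index tuple of length `k ≤ n` defines the decreasing flag of spans of its tails, and
`flagMap` sends `x_m` to the 0-1 vector recording which of these spans contain `α_m`. The induced
map of exterior algebras kills the Orlik–Solomon ideal: a dependent tuple has two members with equal
0-1 vectors (`exists_ne_forall_mem_iff`), so its boundary vanishes, and a tuple with empty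
intersection has more than `n ≥ k` factors. Composing with the determinant gives a functional
`flagCoeff` on the algebra. On NBC monomials these functionals are dual to the monomials
(`flagCoeff_monomial`), which gives independence. Spanning is a straightening argument
(`monomial_mem_span`). The coordinates are therefore the functionals themselves, and their value on
a product of vectors is by construction the stated determinant. -/

noncomputable section

/-- An alternating sum of the values of an alternating map, each at the family with one member
removed, vanishes if two members of the family agree. -/
theorem AlternatingMap.sum_removeNth_eq_zero_of_eq {R M N : Type*} [CommRing R] [AddCommGroup M]
    [Module R M] [AddCommGroup N] [Module R N] {p : ℕ} (f : M [⋀^Fin p]→ₗ[R] N)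
    {v : Fin (p + 1) → M} {a b : Fin (p + 1)} (hv : v a = v b) (hab : a ≠ b) :
    ∑ j : Fin (p + 1), (-1 : R) ^ ((j : ℕ) + 1) • f (fun r => v (j.succAbove r)) = 0 := by
  have key : ∑ j : Fin (p + 1), (-1 : ℤ) ^ (j : ℕ) • f (j.removeNth v) = 0 := by
    rw [Fintype.sum_eq_add a b hab fun k ⟨hka, hkb⟩ => ?_,
      f.neg_one_pow_smul_map_removeNth_add_eq_zero_of_eq hv hab]
    obtain ⟨a, rfl⟩ := Fin.exists_succAbove_eq hka.symm
    obtain ⟨b, rfl⟩ := Fin.exists_succAbove_eq hkb.symm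
    rw [f.map_eq_zero_of_eq _ hv (ne_of_apply_ne _ hab), smul_zero]
  rw [← neg_eq_zero, ← Finset.sum_neg_distrib, ← key]
  refine Finset.sum_congr rfl fun j _ => ?_
  rw [pow_succ, mul_neg_one, neg_smul, neg_neg, ← Int.cast_smul_eq_zsmul R]
  push_cast
  rfl

/-! ### Intersections of hyperplanes and spans of forms -/

/-- A form vanishing on the common kernel of finitely many forms is a combination of them. The zero
vector imposes nothing, so this also covers an empty projective intersection. -/
theorem iInter_projHyperplane_subset_iff {n : ℕ} {ι : Type*} [Finite ι]
    (L : ι → Module.Dual ℂ (Fin (n + 1) → ℂ)) (s : Set ι) (f : Module.Dual ℂ (Fin (n + 1) → ℂ)) :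
    (⋂ r, ⋂ (_ : r ∈ s), projHyperplane (L r)) ⊆ projHyperplane f ↔
      f ∈ Submodule.span ℂ (L '' s) := by
  constructor
  · intro h
    rw [Set.image_eq_range]
    refine mem_span_of_iInf_ker_le_ker fun v hv => ?_
    by_cases hv0 : v = 0
    · simp [hv0]
    have := @h (Projectivization.mk ℂ v hv0) (by
      simp only [Set.mem_iInter]
      intro r hr
      change Projectivization.submodule _ ≤ _
      rw [Projectivization.submodule_mk, Submodule.span_singleton_le_iff_mem]
      exact (Submodule.mem_iInf _).1 hv ⟨r, hr⟩)
    change Projectivization.submodule _ ≤ _ at this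
    rwa [Projectivization.submodule_mk, Submodule.span_singleton_le_iff_mem] at this
  · intro h p hp v hv
    have hle : Submodule.span ℂ (L '' s) ≤ LinearMap.ker (Module.Dual.eval ℂ _ v) := by
      rw [Submodule.span_le]
      rintro _ ⟨r, hr, rfl⟩
      simp only [Set.mem_iInter] at hp
      exact hp r hr hv
    exact hle h

namespace ProjArrangement

variable {n l : ℕ} (A : ProjArrangement n l)

/-- The span of the forms `α_{i_j}, …, α_{i_k}`. -/
def tailSpan {k : ℕ} (i : Fin k → Fin l) (j : Fin k) :
    Submodule ℂ (Module.Dual ℂ (Fin (n + 1) → ℂ)) :=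
  Submodule.span ℂ ((fun r => A.form (i r)) '' Set.Ici j)

theorem tailInter_subset_iff {k : ℕ} (i : Fin k → Fin l) (j : Fin k) (m : Fin l) :
    A.tailInter i j ⊆ A.hyperplane m ↔ A.form m ∈ A.tailSpan i j :=
  iInter_projHyperplane_subset_iff (fun r => A.form (i r)) (Set.Ici j) (A.form m)

theorem tailSpan_antitone {k : ℕ} (i : Fin k → Fin l) : Antitone (A.tailSpan i) := fun _ _ h =>
  Submodule.span_mono (Set.image_mono (Set.Ici_subset_Ici.2 h))

theorem form_mem_tailSpan {k : ℕ} (i : Fin k → Fin l) {j r : Fin k} (h : j ≤ r) :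
    A.form (i r) ∈ A.tailSpan i j :=
  Submodule.subset_span ⟨r, h, rfl⟩

/-- Two members of a dependent tuple of forms lie in the same terms of a chain of subspaces. -/
theorem exists_ne_forall_mem_iff {k : ℕ} {F : Fin k → Submodule ℂ (Module.Dual ℂ (Fin (n + 1) → ℂ))}
    (hF : Antitone F) {p : ℕ} (c : Fin p → Fin l)
    (hc : ¬ LinearIndependent ℂ fun j => A.form (c j)) :
    ∃ a b, a ≠ b ∧ ∀ r, A.form (c a) ∈ F r ↔ A.form (c b) ∈ F r := by
  classical
  rw [Fintype.linearIndependent_iff] at hc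
  push Not at hc
  obtain ⟨g, hg, a₀, ha₀⟩ := hc
  -- Ending the chain with `⊥` makes every nonzero form leave it at a well-defined depth `d`.
  let G : ℕ → Submodule ℂ (Module.Dual ℂ (Fin (n + 1) → ℂ)) :=
    fun r => if h : r < k then F ⟨r, h⟩ else ⊥
  have hG : Antitone G := by
    intro r s hrs
    by_cases hs : s < k
    · have hr : r < k := hrs.trans_lt hs
      simp only [G, hs, hr, dite_true]
      exact hF hrs
    · simp [G, hs]
  have hex : ∀ j, ∃ r, A.form (c j) ∉ G r := fun j => ⟨k, by simp [G, A.form_ne_zero]⟩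
  let d : Fin p → ℕ := fun j => Nat.find (hex j)
  have hd : ∀ j r, A.form (c j) ∈ G r ↔ r < d j := by
    intro j r
    constructor
    · intro h
      by_contra! hr
      exact Nat.find_spec (hex j) (hG hr h)
    · intro h
      exact not_not.1 (Nat.find_min (hex j) h)
  obtain ⟨a, ha, hmin⟩ := Finset.exists_min_image (Finset.univ.filter fun j => g j ≠ 0) d
    ⟨a₀, by simpa using ha₀⟩
  simp only [Finset.mem_filter, Finset.mem_univ, true_and] at ha hmin
  -- If all depths differ from that of `a`, the other forms in the relation lie strictly deeper, so
  -- the relation forces `A.form (c a)` into `G (d a)`, the term it has just left.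
  by_contra! hne
  have hlt : ∀ b, b ≠ a → g b ≠ 0 → d a < d b := by
    intro b hba hb
    refine lt_of_le_of_ne (hmin b hb) fun heq => ?_
    obtain ⟨r, hr⟩ := hne b a hba
    have h1 := hd a r
    have h2 := hd b r
    simp only [G, r.2, dite_true, ← heq, Fin.eta] at h1 h2
    grind
  have hmem : g a • A.form (c a) ∈ G (d a) := by
    rw [← Finset.add_sum_erase _ _ (Finset.mem_univ a)] at hg
    rw [eq_neg_of_add_eq_zero_left hg]
    refine neg_mem (Submodule.sum_mem _ fun b hb => ?_)
    by_cases hgb : g b = 0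
    · simp [hgb]
    · exact Submodule.smul_mem _ _ ((hd b _).2 (hlt b (Finset.ne_of_mem_erase hb) hgb))
  exact lt_irrefl _ ((hd a _).1 ((Submodule.smul_mem_iff _ ha).1 hmem))

/-- Independent forms number at most `n + 1`, and `n + 1` of them span the dual space, leaving no
common projective zero. -/
theorem card_le_of_linearIndependent {k : ℕ} {i : Fin k → Fin l}
    (hi : LinearIndependent ℂ fun j => A.form (i j)) (hne : (A.inter i).Nonempty) : k ≤ n := by
  have hk : k ≤ n + 1 := by simpa using hi.fintype_card_le_finrank
  rcases hk.lt_or_eq with h | rfl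
  · omega
  obtain ⟨q, hq⟩ := hne
  have htop := hi.span_eq_top_of_card_eq_finrank' (by simp)
  exfalso
  refine q.rep_nonzero ((Module.forall_dual_apply_eq_zero_iff ℂ _).1 fun f => ?_)
  have hsub := (iInter_projHyperplane_subset_iff (fun r => A.form (i r)) Set.univ f).2
    (by rw [Set.image_univ, htop]; trivial)
  have := @hsub q (by simpa [inter, hyperplane] using hq)
  exact this (by rw [Projectivization.submodule_eq]; exact Submodule.mem_span_singleton_self _)

theorem inter_nonempty_of_le {k : ℕ} (hk : k ≤ n) (i : Fin k → Fin l) : (A.inter i).Nonempty := by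
  by_contra h
  rw [Set.not_nonempty_iff_eq_empty] at h
  have htop : Submodule.span ℂ (Set.range fun r => A.form (i r)) = ⊤ := by
    refine Submodule.eq_top_iff'.2 fun f => ?_
    rw [← Set.image_univ, ← iInter_projHyperplane_subset_iff]
    have : (⋂ r, projHyperplane (A.form (i r))) = ∅ := h
    simp [this]
  have := finrank_range_le_card (R := ℂ) (fun r => A.form (i r))
  rw [Set.finrank, htop, finrank_top, Subspace.dual_finrank_eq] at this
  simp at this
  omega

/-! ### Functionals attached to flags -/

section Flag

variable {k : ℕ} (i : Fin k → Fin l)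

open Classical in
/-- The linear map `ℂ^l → ℂ^k` whose `r`-th coordinate is the sum of the coordinates belonging to
the hyperplanes containing `H_{i_r} ∩ ⋯ ∩ H_{i_k}`. -/
def flagMap : (Fin l → ℂ) →ₗ[ℂ] (Fin k → ℂ) :=
  LinearMap.pi fun r => ∑ m with A.tailInter i r ⊆ A.hyperplane m, LinearMap.proj m

open Classical in
theorem flagMap_single (m : Fin l) (r : Fin k) :
    A.flagMap i (Pi.single m 1) r = if A.form m ∈ A.tailSpan i r then 1 else 0 := by
  simp only [flagMap, LinearMap.pi_apply, LinearMap.sum_apply, LinearMap.proj_apply, Pi.single_apply,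
    Finset.sum_ite_eq', Finset.mem_filter, Finset.mem_univ, true_and, tailInter_subset_iff]

theorem map_flagMap_extBoundary {p : ℕ} (c : Fin (p + 1) → Fin l)
    (hc : ¬ LinearIndependent ℂ fun j => A.form (c j)) :
    ExteriorAlgebra.map (A.flagMap i) (extBoundary c) = 0 := by
  classical
  obtain ⟨a, b, hab, h⟩ := A.exists_ne_forall_mem_iff (A.tailSpan_antitone i) c hc
  simp only [extBoundary, extMonomial, map_sum, map_smul, ExteriorAlgebra.map_apply_ιMulti]
  refine (ExteriorAlgebra.ιMulti ℂ p).sum_removeNth_eq_zero_of_eq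
    (v := fun j => A.flagMap i (Pi.single (c j) 1)) ?_ hab
  ext r
  simp only [flagMap_single, h r]

theorem map_flagMap_extMonomial {m : ℕ} (c : Fin m → Fin l) (hm : k < m) :
    ExteriorAlgebra.map (A.flagMap i) (extMonomial c) = 0 := by
  rw [extMonomial, ExteriorAlgebra.map_apply_ιMulti]
  refine AlternatingMap.map_linearDependent _ _ fun h => ?_
  have := h.fintype_card_le_finrank
  simp at this
  omega

theorem map_flagMap_eq_zero (hk : k ≤ n) {y : ExteriorAlgebra ℂ (Fin l → ℂ)}
    (hy : y ∈ A.osIdeal) : ExteriorAlgebra.map (A.flagMap i) y = 0 := by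
  rw [← TwoSidedIdeal.mem_ker]
  refine (TwoSidedIdeal.span_le (I := TwoSidedIdeal.ker (ExteriorAlgebra.map (A.flagMap i)))).2 ?_ hy
  rintro _ (⟨p, c, -, hc, rfl⟩ | ⟨m, c, -, hc, rfl⟩)
  · exact (TwoSidedIdeal.mem_ker _).2 (A.map_flagMap_extBoundary i c hc.2)
  -- At most `n` hyperplanes always meet, so this monomial has more than `n ≥ k` factors.
  · refine (TwoSidedIdeal.mem_ker _).2 (A.map_flagMap_extMonomial i c (hk.trans_lt ?_))
    by_contra! hm
    exact (A.inter_nonempty_of_le hm c).ne_empty hc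

/-- The quotient map onto the Orlik-Solomon algebra as a linear map. -/
def toOSLinear : ExteriorAlgebra ℂ (Fin l → ℂ) →ₗ[ℂ] A.OSAlgebra where
  toFun := A.toOS
  map_add' := map_add _
  map_smul' _ _ := rfl

theorem toOSLinear_surjective : Function.Surjective A.toOSLinear :=
  RingCon.mk'_surjective _

theorem toOS_eq_zero_iff {y : ExteriorAlgebra ℂ (Fin l → ℂ)} : A.toOS y = 0 ↔ y ∈ A.osIdeal :=
  (RingCon.eq _).trans (TwoSidedIdeal.mem_iff _ _).symm

/-- The determinant of a product of `k` vectors, extended by zero to the other degrees. -/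
def topDet (k : ℕ) : ExteriorAlgebra ℂ (Fin k → ℂ) →ₗ[ℂ] ℂ :=
  ExteriorAlgebra.liftAlternating fun m =>
    if h : k = m then h ▸ Matrix.detRowAlternating else 0

theorem topDet_ιMulti (v : Fin k → Fin k → ℂ) :
    topDet k (ExteriorAlgebra.ιMulti ℂ k v) = Matrix.det v := by
  simp [topDet, ExteriorAlgebra.liftAlternating_apply_ιMulti]
  rfl

theorem topDet_ιMulti_of_ne {m : ℕ} (h : k ≠ m) (v : Fin m → Fin k → ℂ) :
    topDet k (ExteriorAlgebra.ιMulti ℂ m v) = 0 := by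
  simp [topDet, ExteriorAlgebra.liftAlternating_apply_ιMulti, h]

/-- The linear functional on the Orlik-Solomon algebra attached to the flag of the tail
intersections of an index tuple. -/
def flagCoeff (hk : k ≤ n) : A.OSAlgebra →ₗ[ℂ] ℂ :=
  (LinearMap.ker A.toOSLinear).liftQ (topDet k ∘ₗ (ExteriorAlgebra.map (A.flagMap i)).toLinearMap)
      (fun y hy => by
        have := A.map_flagMap_eq_zero i hk (A.toOS_eq_zero_iff.1 (LinearMap.mem_ker.1 hy))
        simp [this]) ∘ₗ
    (A.toOSLinear.quotKerEquivOfSurjective A.toOSLinear_surjective).symm.toLinearMap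

theorem flagCoeff_toOS (hk : k ≤ n) (y : ExteriorAlgebra ℂ (Fin l → ℂ)) :
    A.flagCoeff i hk (A.toOS y) = topDet k (ExteriorAlgebra.map (A.flagMap i) y) := by
  have : (A.toOSLinear.quotKerEquivOfSurjective A.toOSLinear_surjective).symm (A.toOS y) =
      (LinearMap.ker A.toOSLinear).mkQ y := by
    rw [LinearEquiv.symm_apply_eq]
    rfl
  simp [flagCoeff, this]

theorem flagCoeff_wedge (hk : k ≤ n) (w : Fin k → Fin l → ℂ) :
    A.flagCoeff i hk (A.wedge w) = (Matrix.of fun a => A.flagMap i (w a)).det := by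
  rw [wedge, flagCoeff_toOS, ExteriorAlgebra.map_apply_ιMulti, topDet_ιMulti]
  rfl

theorem flagCoeff_wedge_of_ne (hk : k ≤ n) {m : ℕ} (h : k ≠ m) (w : Fin m → Fin l → ℂ) :
    A.flagCoeff i hk (A.wedge w) = 0 := by
  rw [wedge, flagCoeff_toOS, ExteriorAlgebra.map_apply_ιMulti, topDet_ιMulti_of_ne h]

end Flag

/-! ### Duality with the NBC monomials -/

namespace IsNBC

variable {A} {k : ℕ} {i j : Fin k → Fin l}

theorem isLeast (hi : A.IsNBC i) (r : Fin k) : IsLeast {m | A.form m ∈ A.tailSpan i r} (i r) := by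
  simpa only [tailInter_subset_iff] using hi.first r

/-- The matrix is unitriangular: for `s < r` the index `i s` is below `i r`, the least index in the
`r`-th tail span, so the entry is zero. -/
theorem flagCoeff_self (hi : A.IsNBC i) : A.flagCoeff i hi.le_dim (A.monomial i) = 1 := by
  classical
  rw [monomial, flagCoeff_wedge]
  rw [Matrix.det_of_isLowerTriangular]
  · exact Finset.prod_eq_one fun r _ =>
      (A.flagMap_single i (i r) r).trans (if_pos (A.form_mem_tailSpan i le_rfl))
  · intro s r hsr
    refine (A.flagMap_single i (i s) r).trans (if_neg fun h => ?_)
    exact (hi.strictMono (OrderDual.toDual_lt_toDual.1 hsr)).not_ge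
      ((hi.isLeast r).2 h)

/-- Two non-broken-circuit tuples of the same length agree if the second one is adapted to the flag
of the first one. -/
theorem eq_of_forall_mem_tailSpan (hi : A.IsNBC i) (hj : A.IsNBC j) (σ : Equiv.Perm (Fin k))
    (h : ∀ r, A.form (j (σ r)) ∈ A.tailSpan i r) : i = j := by
  have hsub : Set.range i ⊆ Set.range j := by
    rintro _ ⟨r, rfl⟩
    -- Both sides are spanned by equally many independent forms, so containment is enough.
    have hspan : Submodule.span ℂ (Set.range fun s : Set.Ici r => A.form (j (σ s))) =
        A.tailSpan i r := by
      rw [tailSpan, Set.image_eq_range]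
      refine Submodule.eq_of_le_of_finrank_eq ?_ ?_
      · rw [Submodule.span_le, ← Set.image_eq_range (fun s => A.form (i s))]
        rintro _ ⟨s, rfl⟩
        exact A.tailSpan_antitone i s.2 (h s)
      · have h1 := finrank_span_eq_card (hj.linearIndependent.comp (fun s : Set.Ici r => σ s)
          (σ.injective.comp Subtype.val_injective))
        have h2 := finrank_span_eq_card (hi.linearIndependent.comp (fun s : Set.Ici r => s.1)
          Subtype.val_injective)
        exact h1.trans h2.symm
    -- With `σ s` minimal, the tail of `j` from `σ s` spans the form of `i r`. Leastness of `j (σ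
    -- s)` and of `i r` in their tail spans then gives the two inequalities.
    obtain ⟨s, hs, hmin⟩ := Set.exists_min_image (Set.Ici r) σ (Set.toFinite _) ⟨r, le_refl r⟩
    refine ⟨σ s, le_antisymm ((hj.isLeast (σ s)).2 ?_)
      ((hi.isLeast r).2 (A.tailSpan_antitone i hs (h s)))⟩
    have hir := A.form_mem_tailSpan i (le_refl r)
    rw [← hspan] at hir
    refine Submodule.span_mono ?_ hir
    rintro _ ⟨t, rfl⟩
    exact ⟨σ t, hmin t t.2, rfl⟩
  refine (StrictMono.range_inj hi.strictMono hj.strictMono).1 (Set.eq_of_subset_of_ncard_le hsub ?_)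
  rw [Set.ncard_range_of_injective hi.strictMono.injective,
    Set.ncard_range_of_injective hj.strictMono.injective]

/-- A nonzero term of the Leibniz expansion is a permutation adapting `j` to the flag of `i`, which
would force `i = j`. -/
theorem flagCoeff_of_ne (hi : A.IsNBC i) (hj : A.IsNBC j) (hij : i ≠ j) :
    A.flagCoeff i hi.le_dim (A.monomial j) = 0 := by
  classical
  rw [monomial, flagCoeff_wedge, Matrix.det_apply]
  refine Finset.sum_eq_zero fun σ _ => ?_
  by_contra hne
  refine hij (hi.eq_of_forall_mem_tailSpan hj σ fun r => ?_)
  by_contra hr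
  refine hne ?_
  rw [Finset.prod_eq_zero (Finset.mem_univ r), smul_zero]
  exact (A.flagMap_single i (j (σ r)) r).trans (if_neg hr)

end IsNBC

open Classical in
theorem flagCoeff_monomial (I J : Σ k : ℕ, A.NBC k) :
    A.flagCoeff I.2.1 I.2.2.le_dim (A.monomial J.2.1) = if I = J then 1 else 0 := by
  obtain ⟨k, i, hi⟩ := I
  obtain ⟨m, j, hj⟩ := J
  by_cases hkm : k = m
  · subst hkm
    by_cases hij : i = j
    · subst hij
      simpa using hi.flagCoeff_self
    · rw [if_neg (by simpa using hij)]
      exact hi.flagCoeff_of_ne hj hij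
  · rw [if_neg (by simp [hkm])]
    exact A.flagCoeff_wedge_of_ne i _ hkm _

theorem linearIndependent_monomial :
    LinearIndependent ℂ fun I : Σ k : ℕ, A.NBC k => A.monomial I.2.1 := by
  classical
  rw [linearIndependent_iff']
  intro s g hg I hI
  have := congrArg (A.flagCoeff I.2.1 I.2.2.le_dim) hg
  simpa [flagCoeff_monomial, hI] using this

/-! ### Straightening: the NBC monomials span -/

section Spanning

theorem monomial_eq_zero_of_not_injective {k : ℕ} {i : Fin k → Fin l}
    (hi : ¬ Function.Injective i) : A.monomial i = 0 := by
  simp only [Function.Injective, not_forall] at hi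
  obtain ⟨a, b, hab, hne⟩ := hi
  rw [monomial, wedge, AlternatingMap.map_eq_zero_of_eq _ _ (by simp [hab]) hne, map_zero]

theorem monomial_eq_zero_of_inter_eq_empty {k : ℕ} {i : Fin k → Fin l}
    (hi : A.inter i = ∅) : A.monomial i = 0 := by
  by_cases hinj : Function.Injective i
  · exact A.toOS_eq_zero_iff.2 (TwoSidedIdeal.subset_span (Or.inr ⟨k, i, hinj, hi, rfl⟩))
  · exact A.monomial_eq_zero_of_not_injective hinj

theorem sum_monomial_succAbove_eq_zero {p : ℕ} {i : Fin (p + 1) → Fin l}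
    (hinj : Function.Injective i) (hi : A.NonGeneric i) :
    ∑ j : Fin (p + 1), (-1 : ℂ) ^ ((j : ℕ) + 1) • A.monomial (fun r => i (j.succAbove r)) = 0 := by
  have : A.toOSLinear (extBoundary i) = 0 :=
    A.toOS_eq_zero_iff.2 (TwoSidedIdeal.subset_span (Or.inl ⟨p, i, hinj, hi, rfl⟩))
  simp only [extBoundary, map_sum, map_smul] at this
  exact this

theorem monomial_cons {k : ℕ} (m : Fin l) (i : Fin k → Fin l) :
    A.monomial (Fin.cons m i : Fin (k + 1) → Fin l) =
      A.toOS (ExteriorAlgebra.ι ℂ (Pi.single m 1)) * A.monomial i := by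
  rw [monomial, wedge, ExteriorAlgebra.ιMulti_succ_apply, map_mul]
  rfl

/-- Multiplying the boundary relation by the first generator leaves only the monomial itself, since
every other term repeats that generator. -/
theorem monomial_eq_zero_of_not_linearIndependent {k : ℕ} {i : Fin k → Fin l}
    (hi : ¬ LinearIndependent ℂ fun j => A.form (i j)) : A.monomial i = 0 := by
  by_cases hinj : Function.Injective i
  swap
  · exact A.monomial_eq_zero_of_not_injective hinj
  rcases (A.inter i).eq_empty_or_nonempty with hemp | hne
  · exact A.monomial_eq_zero_of_inter_eq_empty hemp
  obtain _ | p := k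
  · exact absurd linearIndependent_empty_type hi
  have h := congrArg (A.toOS (ExteriorAlgebra.ι ℂ (Pi.single (i 0) 1)) * ·)
    (A.sum_monomial_succAbove_eq_zero hinj ⟨hne, hi⟩)
  simp only [Finset.mul_sum, mul_smul_comm, ← monomial_cons, mul_zero] at h
  rw [Fin.sum_univ_succ, Finset.sum_eq_zero, add_zero] at h
  · have hcons : (Fin.cons (i 0) fun r => i (Fin.succAbove 0 r) : Fin (p + 1) → Fin l) = i :=
      Fin.cons_self_tail i
    rw [hcons] at h
    simpa using h
  · intro j _
    obtain _ | p := p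
    · exact j.elim0
    rw [A.monomial_eq_zero_of_not_injective, smul_zero]
    intro hc
    exact (Fin.succ_ne_zero 0).symm (@hc 0 1 (by
      rw [← Fin.succ_zero_eq_one, Fin.cons_succ, Fin.cons_zero, Fin.succ_succAbove_zero]))

variable {A} in
/-- Either a strictly increasing independent index tuple satisfies the non-broken-circuit
conditions or an index smaller than one of the entries lies in the span of a tail. -/
theorem isNBC_or_exists_lt {k : ℕ} {i : Fin k → Fin l} (hk : k ≤ n) (hmono : StrictMono i)
    (hi : LinearIndependent ℂ fun j => A.form (i j)) :
    A.IsNBC i ∨ ∃ j m, m < i j ∧ A.form m ∈ A.tailSpan i j := by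
  refine or_iff_not_imp_right.2 fun h => ⟨hk, hmono, hi, fun j => ?_⟩
  push Not at h
  simp only [tailInter_subset_iff]
  exact ⟨A.form_mem_tailSpan i le_rfl, fun m hm => not_lt.1 fun hlt => h j m hlt hm⟩

/-- Induction on the sum of the indices. If a sorted independent tuple is not NBC, some `m < i j`
has its form in the `j`-th tail span; the boundary relation of `m` followed by `i` rewrites the
monomial through those with one `i s` replaced by `m`. -/
theorem monomial_mem_span {k : ℕ} (i : Fin k → Fin l) :
    A.monomial i ∈ Submodule.span ℂ (Set.range fun I : Σ k : ℕ, A.NBC k => A.monomial I.2.1) := by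
  induction hN : ∑ r, (i r : ℕ) using Nat.strong_induction_on generalizing i with
  | _ N ih =>
  subst hN
  by_cases hinj : Function.Injective i
  swap
  · rw [A.monomial_eq_zero_of_not_injective hinj]
    exact zero_mem _
  -- Sorting changes the monomial only by a sign and preserves the index sum.
  wlog hmono : StrictMono i generalizing i
  · have hs : StrictMono (i ∘ Tuple.sort i) :=
      (Tuple.monotone_sort i).strictMono_of_injective (hinj.comp (Equiv.injective _))
    have hsum : ∑ r, ((i ∘ Tuple.sort i) r : ℕ) = ∑ r, (i r : ℕ) :=
      Equiv.sum_comp (Tuple.sort i) fun r => (i r : ℕ)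
    have := this (i ∘ Tuple.sort i) (by rwa [hsum]) hs.injective hs
    have hperm : A.monomial (i ∘ Tuple.sort i) =
        A.toOS (Equiv.Perm.sign (Tuple.sort i) •
          ExteriorAlgebra.ιMulti ℂ k fun j => Pi.single (i j) (1 : ℂ)) := by
      rw [← AlternatingMap.map_perm]
      rfl
    rw [hperm] at this
    rcases Int.units_eq_one_or (Equiv.Perm.sign (Tuple.sort i)) with h | h <;> rw [h] at this
    · rwa [one_smul] at this
    · rw [Units.neg_smul, one_smul, map_neg] at this
      exact neg_mem_iff.1 this
  by_cases hi : LinearIndependent ℂ fun j => A.form (i j)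
  swap
  · rw [A.monomial_eq_zero_of_not_linearIndependent hi]
    exact zero_mem _
  rcases (A.inter i).eq_empty_or_nonempty with hemp | hne
  · rw [A.monomial_eq_zero_of_inter_eq_empty hemp]
    exact zero_mem _
  rcases isNBC_or_exists_lt (A.card_le_of_linearIndependent hi hne) hmono hi with h | h
  · exact Submodule.subset_span ⟨⟨k, i, h⟩, rfl⟩
  obtain ⟨j, m, hm, hmem⟩ := h
  obtain _ | k := k
  · exact j.elim0
  let c : Fin (k + 2) → Fin l := Fin.cons m i
  have hform : (fun r => A.form (c r)) = Fin.cons (A.form m) fun r => A.form (i r) := by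
    ext r : 1
    cases r using Fin.cases <;> rfl
  have hnotmem : m ∉ Set.range i := by
    rintro ⟨s, rfl⟩
    refine hi.notMem_span_image (s := Set.Ici j) (x := s) ?_ hmem
    simpa using hmono.lt_iff_lt.1 hm
  have hcinj : Function.Injective c := Fin.cons_injective_iff.2 ⟨hnotmem, hinj⟩
  have hmspan : A.form m ∈ Submodule.span ℂ (Set.range fun r => A.form (i r)) :=
    Submodule.span_mono (Set.image_subset_range _ _) hmem
  have hcdep : ¬ LinearIndependent ℂ fun r => A.form (c r) := by
    rw [hform, linearIndependent_finCons]
    exact fun h => h.2 hmspan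
  have hcne : (A.inter c).Nonempty := by
    obtain ⟨q, hq⟩ := hne
    refine ⟨q, Set.mem_iInter.2 fun r => ?_⟩
    cases r using Fin.cases with
    | zero =>
      refine (iInter_projHyperplane_subset_iff (fun r => A.form (i r)) Set.univ (A.form m)).2
        (by rwa [Set.image_univ]) ?_
      simpa [inter, hyperplane] using hq
    | succ r => exact Set.mem_iInter.1 hq r
  have hrel := A.sum_monomial_succAbove_eq_zero hcinj ⟨hcne, hcdep⟩
  rw [Fin.sum_univ_succ] at hrel
  have hzero : (fun r => c (Fin.succAbove 0 r)) = i := rfl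
  rw [hzero, Fin.val_zero, zero_add, pow_one, neg_smul, one_smul] at hrel
  rw [← neg_mem_iff, eq_neg_of_add_eq_zero_left hrel]
  refine neg_mem (Submodule.sum_mem _ fun s _ => Submodule.smul_mem _ _ ?_)
  have hcomp : (fun r => c (s.succ.succAbove r)) = Fin.cons m fun r => i (s.succAbove r) := by
    ext r : 1
    cases r using Fin.cases with
    | zero => rfl
    | succ r => simp only [Fin.succ_succAbove_succ, c, Fin.cons_succ]
  rw [hcomp]
  -- For `j ≤ s` the index sum drops, because `m < i j ≤ i s`. For `s < j` the whole tail from `j`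
  -- survives beside `m`, so the new tuple is dependent and its monomial is zero.
  by_cases hs : j ≤ s
  · refine ih _ ?_ _ rfl
    rw [Fin.sum_univ_succ, Fin.sum_univ_succAbove (fun r => (i r : ℕ)) s]
    simp only [Fin.cons_zero, Fin.cons_succ]
    exact Nat.add_lt_add_right (hm.trans_le (hmono.monotone hs)) _
  · rw [A.monomial_eq_zero_of_not_linearIndependent]
    · exact zero_mem _
    have hform' : (fun r => A.form ((Fin.cons m fun r => i (s.succAbove r) : Fin (k + 1) → Fin l) r))
        = Fin.cons (A.form m) fun r => A.form (i (s.succAbove r)) := by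
      ext r : 1
      cases r using Fin.cases <;> rfl
    rw [hform', linearIndependent_finCons]
    refine fun h => h.2 (Submodule.span_mono ?_ hmem)
    rintro _ ⟨t, ht, rfl⟩
    have hts : t ≠ s := by
      rintro rfl
      exact hs ht
    obtain ⟨r, rfl⟩ := Fin.exists_succAbove_eq hts
    exact ⟨r, rfl⟩

theorem wedge_mem_span {k : ℕ} (w : Fin k → Fin l → ℂ) :
    A.wedge w ∈ Submodule.span ℂ (Set.range fun I : Σ k : ℕ, A.NBC k => A.monomial I.2.1) := by
  have hw : w = fun j => ∑ m, w j m • (Pi.single m (1 : ℂ) : Fin l → ℂ) := by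
    ext j m
    simp [Pi.single_apply]
  have : A.wedge w = A.toOSLinear ((ExteriorAlgebra.ιMulti ℂ k).toMultilinearMap w) := rfl
  rw [this, hw, MultilinearMap.map_sum, map_sum]
  refine Submodule.sum_mem _ fun c _ => ?_
  rw [MultilinearMap.map_smul_univ, map_smul]
  exact Submodule.smul_mem _ _ (A.monomial_mem_span c)

theorem span_monomial_eq_top :
    Submodule.span ℂ (Set.range fun I : Σ k : ℕ, A.NBC k => A.monomial I.2.1) = ⊤ := by
  rw [eq_top_iff, ← LinearMap.range_eq_top.2 A.toOSLinear_surjective, LinearMap.range_eq_map,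
    ← ExteriorAlgebra.ιMulti_span, Submodule.map_span_le]
  rintro _ ⟨⟨k, w⟩, rfl⟩
  exact A.wedge_mem_span w

end Spanning

/-! ### The basis and its coordinates -/

/-- The basis of non-broken-circuit monomials of the Orlik-Solomon algebra. -/
def nbcBasis : Module.Basis (Σ k : ℕ, A.NBC k) ℂ A.OSAlgebra :=
  Module.Basis.mk A.linearIndependent_monomial A.span_monomial_eq_top.ge

theorem nbcBasis_apply (I : Σ k : ℕ, A.NBC k) : A.nbcBasis I = A.monomial I.2.1 :=
  Module.Basis.mk_apply _ _ I

/-- Both sides are linear in `y` and agree on the basis by duality. -/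
theorem nbcBasis_repr (y : A.OSAlgebra) (I : Σ k : ℕ, A.NBC k) :
    A.nbcBasis.repr y I = A.flagCoeff I.2.1 I.2.2.le_dim y := by
  classical
  have : A.nbcBasis.coord I = A.flagCoeff I.2.1 I.2.2.le_dim := by
    refine A.nbcBasis.ext fun J => ?_
    rw [Module.Basis.coord_apply, Module.Basis.repr_self, nbcBasis_apply, flagCoeff_monomial,
      Finsupp.single_apply]
    simp only [eq_comm]
  exact LinearMap.congr_fun this y

theorem flagMap_eq_decoration (w : Fin n → Fin l → ℂ) (i : Fin n → Fin l) (a k : Fin n) :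
    A.flagMap i (w a) k = A.decoration w (A.tailInter i k) a := by
  simp [flagMap, decoration]

end ProjArrangement

end

/-- The NBC monomials form a basis of the Orlik-Solomon algebra, and in the expansion of
`w_1 ∧ ⋯ ∧ w_n` in this basis the coefficient of `x_{i_1} ∧ ⋯ ∧ x_{i_n}` is the determinant whose
`k`-th column is the sum of the `v_i` over all `H_i` containing `H_{i_k} ∩ ⋯ ∩ H_{i_n}`; the
coefficients of the NBC monomials of other degrees vanish. -/
theorem mainTheorem5 (n l : ℕ) (A : ProjArrangement n l) :
    ∃ b : Module.Basis (Σ k : ℕ, A.NBC k) ℂ A.OSAlgebra,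
      (∀ I, b I = A.monomial I.2.1) ∧
      ∀ w : Fin n → Fin l → ℂ,
        (∀ i : A.NBC n, b.repr (A.wedge w) ⟨n, i⟩ =
          Matrix.det (Matrix.of fun a k : Fin n => A.decoration w (A.tailInter i.1 k) a)) ∧
        (∀ I : Σ k : ℕ, A.NBC k, I.1 ≠ n → b.repr (A.wedge w) I = 0) := by
  refine ⟨A.nbcBasis, A.nbcBasis_apply, fun w => ⟨fun i => ?_, fun I hI => ?_⟩⟩
  · rw [A.nbcBasis_repr, A.flagCoeff_wedge]
    congr 1
    ext a k
    exact A.flagMap_eq_decoration w i.1 a k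
  · rw [A.nbcBasis_repr]
    exact A.flagCoeff_wedge_of_ne _ _ hI w
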